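/- Work in ZFC. For a cardinal $\kappa$ let $H(\kappa)$ be the family of all sets whose transitive closure has size $<\kappa$, let $\mathfrak c=2^{\aleph_0}$, and let $N=(H(\mathfrak c^+);\in)$. An *invariant* is a triple $(A,B,E)$ with $A,B\in H(\mathfrak c^+)$, $E\subseteq A\times B$, $\forall a\in A\,\exists b\in B\ (a,b)\in E$ and $\forall b\in B\,\exists a\in A\ (a,b)\notin E$; we write $a\,E\,b$ for $(a,b)\in E$, and, for a set $A'\subseteq A$, $A'\,E\,b$ for $\forall a\in A'\ a\,E\,b$. With this convention $([A]^{\le\omega},B,E)$ is the triple whose first coordinate is the set of all countable (possibly finite) subsets of $A$, a set $A'\in[A]^{\le\omega}$ being related to $b\in B$ iff $A'\,E\,b$. "Limit" means nonzero limit, and limit ordinals and $0$ are even. *Game.* For $\mathcal H=\langle h_\alpha:\alpha<\omega_1\rangle$ in $N$ and $\mathcal B=\langle b_\alpha:\alpha<\omega_1\rangle$ in $B$, the game $\mathcal G_{(A,B,E)}(\mathcal H,\mathcal B)$ on $N$ has length $\omega_1$. In an even step $\alpha$, BAD plays $\ast_\alpha\in H(\omega_1)$, where for limit $\alpha$ he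 must play $\ast_\alpha=\{\ast_\beta:\beta<\alpha,\ \beta\text{ even}\}$. In the odd step $\alpha+1$ that follows, GOOD plays a countable elementary submodel $M_{\alpha+1}\prec N$ with $\{\ast_\alpha,h_\alpha,\{M_\beta:\beta<\alpha,\ \beta\text{ odd}\}\}\in M_{\alpha+1}$. GOOD wins if $\{\alpha<\omega_1:\alpha\text{ even and }A\cap M_{\alpha+1}\,E\,b_\alpha\}$ is stationary. $\diamondsuit_{\mathrm{STR}}((A,B,E),N)$ says: for every $\mathcal H$ in $N$ there is $\mathcal B$ in $B$ such that GOOD has a winning strategy in $\mathcal G_{(A,B,E)}(\mathcal H,\mathcal B)$ on $N$. $\diamondsuit_{\mathrm{EL}}((A,B,E),N)$ says: for every $\mathcal H$ in $N$ there is $\mathcal B$ in $B$ such that for every continuous sequence $\langle\ast_\alpha:\alpha<\omega_1\rangle$ in $H(\omega_1)$ (that is, $\ast_\alpha=\{\ast_\beta:\beta<\alpha\}$ for limit $\alpha$) there is an increasing chain $\langle M_\alpha:\alpha<\omega_1\rangle$ of countable elementary submodels of $N$ such that $\{\ast_\alpha,h_\alpha,\{M_\beta:\beta<\alpha\}\}\in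 M_{\alpha+1}$ for all $\alpha<\omega_1$, and $\{\alpha<\omega_1:A\cap M_{\alpha+1}\,E\,b_\alpha\}$ is stationary. For a triple $(A',B,E')$ with $E'\subseteq A'\times B$, $\Phi(A',B,E')$ says: for every $F:2^{<\omega_1}\to A'$ there is $g:\omega_1\to B$ such that for every $f\in 2^{\omega_1}$ the set $\{\alpha<\omega_1:F(f\restriction\alpha)\,E'\,g(\alpha)\}$ is stationary. **Theorem.** For any invariant $(A,B,E)$ the following are equivalent: 1. $\diamondsuit_{\mathrm{STR}}((A,B,E),H(\mathfrak c^+))$; 2. $\diamondsuit_{\mathrm{EL}}((A,B,E),H(\mathfrak c^+))$; 3. the principle obtained from $\diamondsuit_{\mathrm{EL}}((A,B,E),H(\mathfrak c^+))$ by letting $\langle\ast_\alpha\rangle$ range over the sequences $\ast_\alpha=X\cap\alpha$, $X\subseteq\omega_1$, instead of the continuous sequences; 4. $\Phi([A]^{\le\omega},B,E)$. -/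

import Mathlib

universe u

open scoped Ordinal Cardinal

namespace ParamDiamond

/-! Set theory is carried out in the universe `ZFSet.{u}`.  A sequence of length `ω₁` of sets is
given by a function `Ordinal.{u} → ZFSet.{u}` of which only the values below `ω₁` are ever used. -/

/-! ### Transitive closures and the families `H(κ)` -/

/-- The transitive closure of `x`: the least transitive set that includes `x`
(see `subset_trcl`, `isTransitive_trcl` and `trcl_subset`). -/
noncomputable def trcl (x : ZFSet.{u}) : ZFSet.{u} :=
  ZFSet.sep (fun y => ∀ t : ZFSet.{u}, t.IsTransitive → x ⊆ t → y ∈ t)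
    (ZFSet.vonNeumann x.rank)

theorem mem_trcl {x y : ZFSet.{u}} :
    y ∈ trcl x ↔ ∀ t : ZFSet.{u}, t.IsTransitive → x ⊆ t → y ∈ t := by
  refine ZFSet.mem_sep.trans ⟨And.right, fun h => ⟨?_, h⟩⟩
  exact h _ (ZFSet.isTransitive_vonNeumann _) (ZFSet.subset_vonNeumann_self x)

theorem subset_trcl (x : ZFSet.{u}) : x ⊆ trcl x :=
  fun _ hy => mem_trcl.2 fun _ _ hx => hx hy

theorem isTransitive_trcl (x : ZFSet.{u}) : (trcl x).IsTransitive :=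
  fun _ hy _ hz => mem_trcl.2 fun t ht hx => ht.subset_of_mem (mem_trcl.1 hy t ht hx) hz

theorem trcl_subset {x t : ZFSet.{u}} (ht : t.IsTransitive) (hx : x ⊆ t) : trcl x ⊆ t :=
  fun _ hy => mem_trcl.1 hy t ht hx

/-- `H(κ)`: all sets whose transitive closure has size `< κ`. -/
def HSet (κ : Cardinal.{u}) : Set ZFSet.{u} :=
  {x | (trcl x).card < κ}

/-! ### Countable elementary submodels of `(N; ∈)` -/

/-- The only symbol of the language of set theory: a binary relation symbol. -/
inductive MemSymbol : ℕ → Type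
  | mem : MemSymbol 2

/-- The first-order language of set theory. -/
def setLang : FirstOrder.Language.{0, 0} where
  Functions := fun _ => Empty
  Relations := MemSymbol

/-- A family `N` of sets as the structure `(N; ∈)`. -/
instance memStructure (N : Set ZFSet.{u}) : setLang.Structure N where
  funMap := fun f => Empty.elim f
  RelMap := fun r => match r with
    | MemSymbol.mem => fun v => (v 0 : ZFSet.{u}) ∈ (v 1 : ZFSet.{u})

/-- `M` is a countable set and `(M; ∈)` is an elementary submodel of `(N; ∈)`. -/
def IsCountableElementary (M : ZFSet.{u}) (N : Set ZFSet.{u}) : Prop :=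
  (M : Set ZFSet.{u}).Countable ∧
    ∃ S : setLang.ElementarySubstructure N,
      ∀ x : ZFSet.{u}, x ∈ M ↔ ∃ hx : x ∈ N, (⟨x, hx⟩ : N) ∈ S

/-! ### Invariants -/

/-- `(A, B, E)` is an invariant. -/
structure IsInvariant (A B E : ZFSet.{u}) : Prop where
  left_mem : A ∈ HSet (Order.succ 𝔠)
  right_mem : B ∈ HSet (Order.succ 𝔠)
  rel_subset : E ⊆ A.prod B
  total : ∀ a ∈ A, ∃ b ∈ B, ZFSet.pair a b ∈ E
  unbounded : ∀ b ∈ B, ∃ a ∈ A, ZFSet.pair a b ∉ E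

/-- `[A]^{≤ ω}`, the set of all countable (possibly finite) subsets of `A`. -/
noncomputable def countableSubsets (A : ZFSet.{u}) : ZFSet.{u} :=
  ZFSet.sep (fun a => (a : Set ZFSet.{u}).Countable) A.powerset

/-- The relation of the triple `([A]^{≤ ω}, B, E)`: the set `a` is related to `b` if and only if
every element of `a` is `E`-related to `b`. -/
noncomputable def liftRel (A B E : ZFSet.{u}) : ZFSet.{u} :=
  ZFSet.pairSep (fun a b => ∀ x ∈ a, ZFSet.pair x b ∈ E) (countableSubsets A) B

/-- `Φ(A, B, E)`: for every `F : 2^{<ω₁} → A` there is `g : ω₁ → B` such that for all `f ∈ 2^{ω₁}`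
the set `{α < ω₁ | F(f ↾ α) E g(α)}` is stationary.  Here `F α` is the restriction of `F` to
`2^α`. -/
def Phi (A B E : ZFSet.{u}) : Prop :=
  ∀ F : (α : Ordinal.{u}) → (Set.Iio α → Bool) → ZFSet.{u},
    (∀ α < ω₁, ∀ s : Set.Iio α → Bool, F α s ∈ A) →
    ∃ g : Ordinal.{u} → ZFSet.{u}, (∀ α < ω₁, g α ∈ B) ∧
      ∀ f : Set.Iio (ω₁ : Ordinal.{u}) → Bool,
        IsStationary {α : Set.Iio (ω₁ : Ordinal.{u}) |
          ZFSet.pair (F α.1 fun β : Set.Iio α.1 =>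
            f ⟨β.1, Set.mem_Iio.2 ((Set.mem_Iio.1 β.2).trans (Set.mem_Iio.1 α.2))⟩) (g α.1) ∈ E}

/-- The relation `A ∩ M E b`: every `a ∈ A ∩ M` is `E`-related to `b`. -/
def Captures (A E M b : ZFSet.{u}) : Prop :=
  ∀ a ∈ A ∩ M, ZFSet.pair a b ∈ E

/-! ### The game and the strategic diamond -/

/-- Even ordinals, that is `λ + 2n` with `λ` zero or limit and `n < ω`. -/
def IsEvenOrd (α : Ordinal.{u}) : Prop := ∃ γ : Ordinal.{u}, α = 2 * γ

/-- BAD obeys the rules in the play `x`: in every even step he plays an element of `H(ω₁)`, and in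
a limit step `α` he plays `{x β | β < α, β even}`. -/
def BadLegal (x : Ordinal.{u} → ZFSet.{u}) : Prop :=
  ∀ α < ω₁, IsEvenOrd α → x α ∈ HSet ℵ₁ ∧
    (Order.IsSuccLimit α →
      x α = ZFSet.range fun β : {β : Set.Iio α // IsEvenOrd β.1} => x β.1.1)

/-- GOOD obeys the rules in the play `x` on `N` with parameters `h`: in every odd step `α + 1` she
plays a countable elementary submodel `x (α + 1)` of `N` which has
`{x α, h α, {x β | β < α, β odd}}` as an element. -/
def GoodLegal (N : Set ZFSet.{u}) (h x : Ordinal.{u} → ZFSet.{u}) : Prop :=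
  ∀ α < ω₁, IsEvenOrd α →
    IsCountableElementary (x (α + 1)) N ∧
    ({x α, h α, ZFSet.range fun β : {β : Set.Iio α // ¬ IsEvenOrd β.1} => x β.1.1} : ZFSet.{u})
      ∈ x (α + 1)

/-- The winning condition of GOOD in the play `x`. -/
def GoodWins (A E : ZFSet.{u}) (b x : Ordinal.{u} → ZFSet.{u}) : Prop :=
  IsStationary {α : Set.Iio (ω₁ : Ordinal.{u}) |
    IsEvenOrd α.1 ∧ Captures A E (x (α.1 + 1)) (b α.1)}

/-- A strategy of GOOD assigns to an even step `α` and the moves made in the steps `≤ α` (by both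
players) a move for the step `α + 1`. -/
abbrev Strategy : Type (u + 1) :=
  (α : Ordinal.{u}) → (Set.Iic α → ZFSet.{u}) → ZFSet.{u}

/-- In the play `x` GOOD follows the strategy `σ`. -/
def Strategy.Follows (σ : Strategy.{u}) (x : Ordinal.{u} → ZFSet.{u}) : Prop :=
  ∀ α < ω₁, IsEvenOrd α → x (α + 1) = σ α fun β : Set.Iic α => x β.1

/-- `σ` is a winning strategy of GOOD in the game `G_{(A,B,E)}(h, b)` on `N`: in every play in
which she follows it and BAD obeys the rules, she obeys the rules too and wins. -/
def Strategy.IsWinning (σ : Strategy.{u}) (A E : ZFSet.{u}) (N : Set ZFSet.{u})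
    (h b : Ordinal.{u} → ZFSet.{u}) : Prop :=
  ∀ x : Ordinal.{u} → ZFSet.{u}, BadLegal x → σ.Follows x → GoodLegal N h x ∧ GoodWins A E b x

/-- The strategic diamond `◇_STR((A,B,E), N)`. -/
def DiamondSTR (A B E : ZFSet.{u}) (N : Set ZFSet.{u}) : Prop :=
  ∀ h : Ordinal.{u} → ZFSet.{u}, (∀ α < ω₁, h α ∈ N) →
    ∃ b : Ordinal.{u} → ZFSet.{u}, (∀ α < ω₁, b α ∈ B) ∧
      ∃ σ : Strategy.{u}, σ.IsWinning A E N h b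

/-! ### The elementary diamond -/

/-- `s` is a continuous sequence of elements of `H(ω₁)`: `s α = {s β | β < α}` at limits `α`. -/
def IsContinuousSeq (s : Ordinal.{u} → ZFSet.{u}) : Prop :=
  (∀ α < ω₁, s α ∈ HSet ℵ₁) ∧
    ∀ α < ω₁, Order.IsSuccLimit α → s α = ZFSet.range fun β : Set.Iio α => s β.1

/-- `s` is the sequence of the sets `X ∩ α`, for some `X ⊆ ω₁`. -/
def IsInitialSegmentSeq (s : Ordinal.{u} → ZFSet.{u}) : Prop :=
  ∃ X : ZFSet.{u}, X ⊆ (ω₁ : Ordinal.{u}).toZFSet ∧ ∀ α < ω₁, s α = X ∩ α.toZFSet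

/-- `M` is an increasing chain of countable elementary submodels of `N` with
`{s α, h α, {M β | β < α}} ∈ M (α + 1)` for all `α < ω₁`. -/
def IsModelChain (N : Set ZFSet.{u}) (h s M : Ordinal.{u} → ZFSet.{u}) : Prop :=
  (∀ α < ω₁, IsCountableElementary (M α) N) ∧
  (∀ α < ω₁, ∀ β < α, M β ⊆ M α) ∧
  ∀ α < ω₁,
    ({s α, h α, ZFSet.range fun β : Set.Iio α => M β.1} : ZFSet.{u}) ∈ M (α + 1)

/-- The elementary diamond for the sequences `s` with the property `P`. -/
def DiamondELFor (P : (Ordinal.{u} → ZFSet.{u}) → Prop) (A B E : ZFSet.{u})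
    (N : Set ZFSet.{u}) : Prop :=
  ∀ h : Ordinal.{u} → ZFSet.{u}, (∀ α < ω₁, h α ∈ N) →
    ∃ b : Ordinal.{u} → ZFSet.{u}, (∀ α < ω₁, b α ∈ B) ∧
      ∀ s : Ordinal.{u} → ZFSet.{u}, P s →
        ∃ M : Ordinal.{u} → ZFSet.{u}, IsModelChain N h s M ∧
          IsStationary {α : Set.Iio (ω₁ : Ordinal.{u}) |
            Captures A E (M (α.1 + 1)) (b α.1)}

/-- The elementary diamond `◇_EL((A,B,E), N)`. -/
def DiamondEL (A B E : ZFSet.{u}) (N : Set ZFSet.{u}) : Prop :=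
  DiamondELFor IsContinuousSeq A B E N

/-- The elementary diamond restricted to the sequences `X ∩ α`, for `X ⊆ ω₁`. -/
def DiamondELInitial (A B E : ZFSet.{u}) (N : Set ZFSet.{u}) : Prop :=
  DiamondELFor IsInitialSegmentSeq A B E N

end ParamDiamond

namespace ParamDiamond

/-! ### Closure properties of `H(κ)` -/

/-! Each of the three diamonds is equivalent to `Φ` for `([A]^{≤ω}, B, E)`.

From `Φ` to a diamond: for given `h`, every sequence `s` determines a `chain` of countable hulls,
and its model with index `α + 1` depends only on the values of `s` up to `α` (`chain_congr`). For
club many `α` these values can be read off `f ↾ α`, for a suitable `f ∈ 2^{ω₁}` (`Decodes`). Hence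
`F(f ↾ α) = A ∩ M_{α+1}` is a legitimate instance of `Φ`, and its guessing function is the required
sequence `b` (`exists_guess_of_phi`). Elements of `H(ω₁)` are coded by reals, and continuity
supplies the values at limits. In the game the same chain, computed from BAD's moves so far, is a
strategy of GOOD.

From a diamond to `Φ`: for given `F`, let `h α` be a function that sends a code of `t ∈ 2^α`
together with a number `n` to the `n`-th element of `F(t)`. It belongs to `H(𝔠⁺)` because `2^α` has
size at most `𝔠` (`codeGraph_mem_HSet`). If the sequence played consists of codes of the
restrictions `f ↾ α`, then `M_{α+1}` contains both `h α` and the code, so by elementarity it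
includes `F(f ↾ α)`; whatever captures `A ∩ M_{α+1}` therefore captures `F(f ↾ α)` (`phi_of_codes`).
The codes must form a sequence that the diamond admits: sets `X ∩ α` in one case (`ordSet`),
continuous sequences in the others (`limitCode`). -/

theorem trcl_subset_trcl {x y : ZFSet.{u}} (h : y ∈ x) : trcl y ⊆ trcl x :=
  trcl_subset (isTransitive_trcl x)
    ((isTransitive_trcl x).subset_of_mem (subset_trcl x h))

theorem mem_HSet_of_mem {κ : Cardinal.{u}} {x y : ZFSet.{u}} (hx : x ∈ HSet κ) (h : y ∈ x) :
    y ∈ HSet κ :=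
  (ZFSet.card_mono (trcl_subset_trcl h)).trans_lt hx

theorem card_lt_of_mem_HSet {κ : Cardinal.{u}} {x : ZFSet.{u}} (hx : x ∈ HSet κ) : x.card < κ :=
  (ZFSet.card_mono (subset_trcl x)).trans_lt hx

theorem HSet_mono {κ μ : Cardinal.{u}} (h : κ ≤ μ) : HSet κ ⊆ HSet μ :=
  fun _ hx => lt_of_lt_of_le hx h

theorem trcl_subset_union (x : ZFSet.{u}) :
    trcl x ⊆ x ∪ ZFSet.iUnion fun y : x => trcl y.1 := by
  refine trcl_subset ?_ fun y hy => ZFSet.mem_union.2 (.inl hy)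
  intro y hy z hz
  rw [ZFSet.mem_union, ZFSet.mem_iUnion] at hy ⊢
  right
  rcases hy with hy | ⟨w, hw⟩
  · exact ⟨⟨y, hy⟩, subset_trcl y hz⟩
  · exact ⟨w, (isTransitive_trcl _).subset_of_mem hw hz⟩

/-- The transitive closure of `x` is covered by `x` and the transitive closures of its elements, and
a union of at most `κ` sets of size at most `κ` has size at most `κ`. -/
theorem mem_HSet_succ_of_forall_mem {κ : Cardinal.{u}} (hκ : ℵ₀ ≤ κ) {x : ZFSet.{u}}
    (hx : x.card ≤ κ) (h : ∀ y ∈ x, y ∈ HSet (Order.succ κ)) : x ∈ HSet (Order.succ κ) := by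
  have hs : (ZFSet.iUnion fun y : x => trcl y.1).card ≤ κ := by
    rw [← Cardinal.lift_le.{u + 1}]
    refine ZFSet.lift_card_iUnion_le_sum_card.trans ?_
    refine (Cardinal.sum_le_sum _ (fun _ => κ) fun y => Order.lt_succ_iff.1 (h _ y.2)).trans ?_
    rw [Cardinal.sum_const, ZFSet.cardinalMk_coe_sort, Cardinal.lift_umax.{u, u + 1},
      Cardinal.lift_lift, ← Cardinal.lift_mul, Cardinal.lift_le]
    exact (mul_le_mul' hx le_rfl).trans (Cardinal.mul_eq_self hκ).le
  refine Order.lt_succ_iff.2 ((ZFSet.card_mono (trcl_subset_union x)).trans ?_)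
  exact ZFSet.card_union_le.trans ((add_le_add hx hs).trans (Cardinal.add_eq_self hκ).le)

theorem card_le_aleph0_iff {x : ZFSet.{u}} :
    x.card ≤ ℵ₀ ↔ (x : Set ZFSet.{u}).Countable := by
  rw [← Cardinal.le_aleph0_iff_set_countable, ← Cardinal.lift_le.{u + 1}, Cardinal.lift_aleph0,
    ← ZFSet.cardinalMk_coe_sort]
  rfl

theorem mem_HSet_succ_of_countable {κ : Cardinal.{u}} (hκ : ℵ₀ ≤ κ) {x : ZFSet.{u}}
    (hx : (x : Set ZFSet.{u}).Countable) (h : ∀ y ∈ x, y ∈ HSet (Order.succ κ)) :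
    x ∈ HSet (Order.succ κ) :=
  mem_HSet_succ_of_forall_mem hκ ((card_le_aleph0_iff.2 hx).trans hκ) h

theorem mem_HSet_aleph_one_of_countable {x : ZFSet.{u}}
    (hx : (x : Set ZFSet.{u}).Countable) (h : ∀ y ∈ x, y ∈ HSet ℵ₁) : x ∈ HSet ℵ₁ := by
  rw [← Cardinal.succ_aleph0] at h ⊢
  exact mem_HSet_succ_of_countable le_rfl hx h

theorem countable_of_mem_HSet_aleph_one {x : ZFSet.{u}} (hx : x ∈ HSet ℵ₁) :
    (x : Set ZFSet.{u}).Countable := by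
  rw [← Cardinal.succ_aleph0] at hx
  exact card_le_aleph0_iff.1 (Order.lt_succ_iff.1 (card_lt_of_mem_HSet hx))

theorem HSet_aleph_one_subset : HSet.{u} ℵ₁ ⊆ HSet (Order.succ 𝔠) := by
  rw [← Cardinal.succ_aleph0]
  exact HSet_mono (Order.succ_le_succ Cardinal.aleph0_le_continuum)

theorem countable_insert {x y : ZFSet.{u}} (hy : (y : Set ZFSet.{u}).Countable) :
    ((insert x y : ZFSet.{u}) : Set ZFSet.{u}).Countable := by
  rw [ZFSet.coe_insert]
  exact hy.insert x

theorem countable_singleton (x : ZFSet.{u}) : (({x} : ZFSet.{u}) : Set ZFSet.{u}).Countable := by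
  rw [ZFSet.coe_singleton]
  exact Set.countable_singleton x

theorem countable_range {ι : Type*} [Countable ι] (f : ι → ZFSet.{u}) [Small.{u} ι] :
    (ZFSet.range f : Set ZFSet.{u}).Countable := by
  rw [ZFSet.coe_range]
  exact Set.countable_range f

section Succ

variable {κ : Cardinal.{u}} (hκ : ℵ₀ ≤ κ) {x y z : ZFSet.{u}}
include hκ

theorem singleton_mem_HSet (hx : x ∈ HSet (Order.succ κ)) : {x} ∈ HSet (Order.succ κ) :=
  mem_HSet_succ_of_countable hκ (countable_singleton x) (by simpa using hx)

theorem insert_pair_mem_HSet (hx : x ∈ HSet (Order.succ κ)) (hy : y ∈ HSet (Order.succ κ))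
    (hz : z ∈ HSet (Order.succ κ)) : {x, y, z} ∈ HSet (Order.succ κ) :=
  mem_HSet_succ_of_countable hκ (countable_insert (countable_insert (countable_singleton z)))
    (by simp [hx, hy, hz])

theorem unordered_pair_mem_HSet (hx : x ∈ HSet (Order.succ κ)) (hy : y ∈ HSet (Order.succ κ)) :
    {x, y} ∈ HSet (Order.succ κ) :=
  mem_HSet_succ_of_countable hκ (countable_insert (countable_singleton y)) (by simp [hx, hy])

theorem pair_mem_HSet (hx : x ∈ HSet (Order.succ κ)) (hy : y ∈ HSet (Order.succ κ)) :
    ZFSet.pair x y ∈ HSet (Order.succ κ) :=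
  unordered_pair_mem_HSet hκ (singleton_mem_HSet hκ hx) (unordered_pair_mem_HSet hκ hx hy)

end Succ

/-! ### Countable ordinals and club subsets of `ω₁` -/

theorem countable_Iio {α : Ordinal.{u}} (h : α < ω₁) : Countable (Set.Iio α) := by
  rw [← Cardinal.mk_le_aleph0_iff, Cardinal.mk_Iio_ordinal, Cardinal.lift_le_aleph0]
  rw [← Cardinal.ord_aleph, Cardinal.lt_ord, ← Cardinal.succ_aleph0] at h
  exact Order.lt_succ_iff.1 h

theorem isSuccLimit_omega_one : Order.IsSuccLimit (ω₁ : Ordinal.{u}) :=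
  Cardinal.isSuccLimit_omega 1

theorem add_one_lt_omega_one {α : Ordinal.{u}} (h : α < ω₁) : α + 1 < ω₁ :=
  isSuccLimit_omega_one.add_one_lt h

theorem countable_toZFSet {α : Ordinal.{u}} (h : α < ω₁) :
    (α.toZFSet : Set ZFSet.{u}).Countable := by
  have := countable_Iio h
  rw [Ordinal.coe_toZFSet]
  exact (Set.to_countable _).image _

theorem toZFSet_mem_HSet {α : Ordinal.{u}} (h : α < ω₁) : α.toZFSet ∈ HSet ℵ₁ := by
  induction α using WellFoundedLT.induction with
  | _ α ih =>
    refine mem_HSet_aleph_one_of_countable (countable_toZFSet h) fun y hy => ?_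
    obtain ⟨β, hβ, rfl⟩ := Ordinal.mem_toZFSet_iff.1 hy
    exact ih β hβ (hβ.trans h)

theorem cof_Iio_omega_one : Order.cof (Set.Iio (ω₁ : Ordinal.{u})) ≠ ℵ₀ := by
  rw [Ordinal.cof_Iio]
  simp [Cardinal.aleph0_lt_aleph_one.ne']

theorem isStationary_inter_isClub {S C : Set (Set.Iio (ω₁ : Ordinal.{u}))} (hS : IsStationary S)
    (hC : IsClub C) : IsStationary (S ∩ C) := fun t ht => by
  rw [Set.inter_assoc]
  exact hS (hC.inter cof_Iio_omega_one ht)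

/-- The closure points of a monotone function form a club. -/
theorem isClub_closurePoints {G : Ordinal.{u} → Ordinal.{u}} (hG : Monotone G)
    (hG' : ∀ β < ω₁, G β < ω₁) :
    IsClub {α : Set.Iio (ω₁ : Ordinal.{u}) | 0 < α.1 ∧ ∀ β < α.1, G β < α.1} := by
  constructor
  · rw [dirSupClosed_iff_of_linearOrder]
    intro d hd hne a ha
    refine ⟨?_, fun β hβ => ?_⟩
    · obtain ⟨x, hx⟩ := hne
      exact (hd hx).1.trans_le (ha.1 hx)
    · obtain ⟨x, hx, hlt⟩ := (lt_isLUB_iff ha (b := ⟨β, hβ.trans a.2⟩)).1 hβ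
      exact ((hd hx).2 β hlt).trans_le (ha.1 hx)
  · intro a
    -- The supremum of the iterates of `G + 1` is a closure point; the start `a + 1` makes it
    -- positive and larger than `a`.
    let g : ℕ → Ordinal.{u} := Nat.rec (a.1 + 1) fun _ γ => G γ + 1
    have hg : ∀ n, g n < ω₁ := fun n => by
      induction n with
      | zero => exact add_one_lt_omega_one a.2
      | succ n ih => exact add_one_lt_omega_one (hG' _ ih)
    have hb : BddAbove (Set.range g) := ⟨ω₁, by rintro _ ⟨n, rfl⟩; exact (hg n).le⟩
    have ha : a.1 < ⨆ n, g n := (lt_add_one a.1).trans_le (le_ciSup hb 0)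
    refine ⟨⟨⨆ n, g n, Ordinal.iSup_lt_omega_one hg⟩, ⟨(zero_le).trans_lt ha, fun β hβ => ?_⟩, ha.le⟩
    obtain ⟨n, hn⟩ := exists_lt_of_lt_ciSup hβ
    exact (hG hn.le).trans_lt ((lt_add_one _).trans_le (le_ciSup hb (n + 1)))

theorem isSuccLimit_of_closed {α : Ordinal.{u}} (h0 : 0 < α) (h : ∀ β < α, β + 1 < α) :
    Order.IsSuccLimit α := by
  rw [Ordinal.isSuccLimit_iff]
  exact ⟨h0.ne', Order.isSuccPrelimit_of_succ_lt (by simpa using h)⟩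

theorem isClub_isSuccLimit :
    IsClub {α : Set.Iio (ω₁ : Ordinal.{u}) | Order.IsSuccLimit α.1} := by
  convert isClub_closurePoints.{u} (G := fun β => β + 1) (fun _ _ h => by simpa using h)
    (fun _ => add_one_lt_omega_one) using 1
  ext α
  exact ⟨fun h => ⟨h.bot_lt, fun β hβ => h.add_one_lt hβ⟩, fun h => isSuccLimit_of_closed h.1 h.2⟩

/-! ### Coding elements of `H(ω₁)` by reals -/

/-- Countably branching well-founded trees. -/
abbrev CountableTree : Type := WType fun b : Bool => if b then ℕ else Empty

/-- The cardinal `𝔠` is large enough because `𝔠 ^ 0 + 𝔠 ^ ℵ₀ ≤ 𝔠`. -/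
theorem mk_countableTree_le : #CountableTree ≤ 𝔠 := by
  refine WType.cardinalMk_le_of_le' ((Cardinal.sum_le_sum _ (fun _ => 𝔠) fun b => ?_).trans ?_)
  · cases b
    · simpa using Cardinal.nat_lt_continuum 1 |>.le
    · simp
  · simp

/-- The set coded by a countably branching well-founded tree. -/
noncomputable def treeSet : CountableTree → ZFSet.{u} :=
  WType.elim _ fun x => ZFSet.range x.2

/-- By `∈`-induction: a leaf codes `∅`, and a nonempty countable set is enumerated by `ℕ`, possibly
with repetitions. -/
theorem exists_treeSet_eq {x : ZFSet.{u}} (hx : x ∈ HSet ℵ₁) : ∃ t, treeSet t = x := by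
  induction x using ZFSet.inductionOn with
  | _ x ih =>
    obtain rfl | ⟨y, hy⟩ := x.eq_empty_or_nonempty
    · refine ⟨⟨false, Empty.elim⟩, ?_⟩
      ext z
      simp [treeSet, WType.elim]
    · obtain ⟨e, he⟩ := (countable_of_mem_HSet_aleph_one hx).exists_eq_range ⟨y, hy⟩
      have he' : ∀ n, e n ∈ x := fun n => by
        change e n ∈ (x : Set ZFSet.{u})
        rw [he]
        exact Set.mem_range_self n
      choose t ht using fun n => ih (e n) (he' n) (mem_HSet_of_mem hx (he' n))
      refine ⟨⟨true, t⟩, ?_⟩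
      rw [← SetLike.coe_set_eq, he, ← funext ht]
      exact ZFSet.coe_range _

theorem exists_real_coding :
    ∃ D : (ℕ → Bool) → ZFSet.{u}, ∀ x ∈ HSet.{u} ℵ₁, ∃ r, D r = x := by
  have h : #CountableTree ≤ #(ℕ → Bool) := by simpa using mk_countableTree_le
  obtain ⟨e⟩ := h
  have : Nonempty CountableTree := ⟨⟨false, Empty.elim⟩⟩
  refine ⟨fun r => treeSet (Function.invFun e r), fun x hx => ?_⟩
  obtain ⟨t, rfl⟩ := exists_treeSet_eq hx
  exact ⟨e t, congrArg treeSet (Function.leftInverse_invFun e.injective t)⟩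

/-! ### Countable elementary hulls -/

theorem IsCountableElementary.subset {M : ZFSet.{u}} {N : Set ZFSet.{u}}
    (h : IsCountableElementary M N) {x : ZFSet.{u}} (hx : x ∈ M) : x ∈ N := by
  obtain ⟨-, S, hS⟩ := h
  exact ((hS x).1 hx).1

theorem infinite_HSet : (HSet.{u} (Order.succ 𝔠)).Infinite := by
  refine Set.infinite_of_injective_forall_mem (f := fun n : ℕ => (n : Ordinal.{u}).toZFSet)
    (fun m n h => by simpa using Ordinal.toZFSet_injective h) fun n => ?_
  exact HSet_aleph_one_subset (toZFSet_mem_HSet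
    ((Ordinal.natCast_lt_omega0 n).trans Ordinal.omega0_lt_omega_one))

theorem card_setLang_le : setLang.card ≤ ℵ₀ := by
  have h : ∀ n, Countable (setLang.Relations n) := fun n =>
    (show Function.Injective (fun _ : MemSymbol n => ()) from
      fun a b _ => by cases a; cases b; rfl).countable
  have h' : ∀ n, Countable (setLang.Functions n) := fun n => inferInstanceAs (Countable Empty)
  have : Countable setLang.Symbols := inferInstanceAs
    (Countable ((Σ n, setLang.Functions n) ⊕ (Σ n, setLang.Relations n)))
  exact Cardinal.mk_le_aleph0

theorem exists_isCountableElementary {N : Set ZFSet.{u}} (hN : N.Infinite) {X : ZFSet.{u}}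
    (hX : (X : Set ZFSet.{u}).Countable) (hXN : ∀ x ∈ X, x ∈ N) :
    ∃ M, IsCountableElementary M N ∧ X ⊆ M := by
  have : Infinite N := hN.to_subtype
  obtain ⟨S, hXS, hS⟩ := setLang.exists_elementarySubstructure_card_eq
    ((↑) ⁻¹' (X : Set ZFSet.{u}) : Set N)
    (ℵ₀ : Cardinal.{0}) le_rfl
    (by simpa using! hX.preimage Subtype.val_injective)
    (by simpa using card_setLang_le) (by simp)
  have : Countable S := by
    rw [← Cardinal.mk_le_aleph0_iff]
    simpa using hS.le
  refine ⟨ZFSet.range fun y : S => y.1.1, ⟨countable_range _, S, fun x => ?_⟩, fun x hx => ?_⟩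
  · rw [ZFSet.mem_range]
    constructor
    · rintro ⟨y, rfl⟩
      exact ⟨y.1.2, y.2⟩
    · rintro ⟨hx, h⟩
      exact ⟨⟨_, h⟩, rfl⟩
  · exact ZFSet.mem_range.2 ⟨⟨⟨x, hXN x hx⟩, hXS hx⟩, rfl⟩

open Classical in
/-- A countable elementary submodel of `N` that includes `X`, or `∅` if there is none. -/
noncomputable def hull (N : Set ZFSet.{u}) (X : ZFSet.{u}) : ZFSet.{u} :=
  if h : ∃ M, IsCountableElementary M N ∧ X ⊆ M then h.choose else ∅

/-- No condition on `X` is imposed, so that `F` takes countable values even at those `t` whose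
decoded sequence leaves `N`. -/
theorem countable_hull (N : Set ZFSet.{u}) (X : ZFSet.{u}) :
    (hull N X : Set ZFSet.{u}).Countable := by
  unfold hull
  split_ifs with h
  · exact h.choose_spec.1.1
  · simp

theorem hull_spec {N : Set ZFSet.{u}} (hN : N.Infinite) {X : ZFSet.{u}}
    (hX : (X : Set ZFSet.{u}).Countable) (hXN : ∀ x ∈ X, x ∈ N) :
    IsCountableElementary (hull N X) N ∧ X ⊆ hull N X := by
  have h := exists_isCountableElementary hN hX hXN
  rw [hull, dif_pos h]
  exact h.choose_spec

/-! ### Chains of hulls -/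

/-- An increasing chain of countable elementary submodels of `N`, in which the model with index
`α + 1` is built from the models with smaller indices, `s α` and `h α`. -/
noncomputable def chain (N : Set ZFSet.{u}) (h s : Ordinal.{u} → ZFSet.{u})
    (α : Ordinal.{u}) : ZFSet.{u} :=
  hull N (ZFSet.iUnion (fun β : Set.Iio α => chain N h s β.1) ∪
    -- The first triple is the one required in a model chain, the second the one required in the
    -- game, so one construction serves both. At nonsuccessors `α.pred = α`, which does no harm.
    {{s α.pred, h α.pred, ZFSet.range fun β : Set.Iio α.pred => chain N h s β.1},
      {s α.pred, h α.pred,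
        ZFSet.range fun β : {β : Set.Iio α.pred // ¬ IsEvenOrd β.1} => chain N h s β.1.1}})
termination_by α
decreasing_by
  · exact β.2
  · exact β.2.trans_le (Ordinal.pred_le_self α)
  · exact β.1.2.trans_le (Ordinal.pred_le_self α)

theorem countable_chain (N : Set ZFSet.{u}) (h s : Ordinal.{u} → ZFSet.{u}) (α : Ordinal.{u}) :
    (chain N h s α : Set ZFSet.{u}).Countable := by
  rw [chain]
  exact countable_hull _ _

theorem chain_congr {N : Set ZFSet.{u}} {h s s' : Ordinal.{u} → ZFSet.{u}} {α : Ordinal.{u}}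
    (H : ∀ β ≤ α.pred, s β = s' β) : chain N h s α = chain N h s' α := by
  induction α using WellFoundedLT.induction with
  | _ α ih =>
    have key : ∀ β < α, chain N h s β = chain N h s' β := fun β hβ =>
      ih β hβ fun γ hγ => H γ (hγ.trans (Ordinal.pred_succ_gi.gc.monotone_l hβ.le))
    have h1 : (fun β : Set.Iio α => chain N h s β.1) = fun β => chain N h s' β.1 :=
      funext fun β => key _ β.2
    have h2 : (fun β : Set.Iio α.pred => chain N h s β.1) = fun β => chain N h s' β.1 :=
      funext fun β => key _ (β.2.trans_le (Ordinal.pred_le_self α))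
    have h3 : (fun β : {β : Set.Iio α.pred // ¬ IsEvenOrd β.1} => chain N h s β.1.1) =
        fun β => chain N h s' β.1.1 :=
      funext fun β => key _ (β.1.2.trans_le (Ordinal.pred_le_self α))
    rw [chain, chain.eq_def N h s', h1, h2, h3, H _ le_rfl]

theorem mem_HSet_of_isCountableElementary {M : ZFSet.{u}}
    (hM : IsCountableElementary M (HSet (Order.succ 𝔠))) : M ∈ HSet (Order.succ 𝔠) :=
  mem_HSet_succ_of_countable Cardinal.aleph0_le_continuum hM.1 fun _ => hM.subset

section

variable {h s : Ordinal.{u} → ZFSet.{u}} (hh : ∀ α < ω₁, h α ∈ HSet (Order.succ 𝔠))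
  (hs : ∀ α < ω₁, s α ∈ HSet (Order.succ 𝔠))
include hh hs

theorem chain_spec {α : Ordinal.{u}} (hα : α < ω₁) :
    IsCountableElementary (chain (HSet (Order.succ 𝔠)) h s α) (HSet (Order.succ 𝔠)) ∧
      (∀ β < α, chain (HSet (Order.succ 𝔠)) h s β ⊆ chain (HSet (Order.succ 𝔠)) h s α) ∧
      {s α.pred, h α.pred, ZFSet.range fun β : Set.Iio α.pred =>
        chain (HSet (Order.succ 𝔠)) h s β.1} ∈ chain (HSet (Order.succ 𝔠)) h s α ∧
      {s α.pred, h α.pred, ZFSet.range fun β : {β : Set.Iio α.pred // ¬ IsEvenOrd β.1} =>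
        chain (HSet (Order.succ 𝔠)) h s β.1.1} ∈ chain (HSet (Order.succ 𝔠)) h s α := by
  induction α using WellFoundedLT.induction with
  | _ α ih =>
    have hp : α.pred < ω₁ := (Ordinal.pred_le_self α).trans_lt hα
    have := countable_Iio hα
    have := countable_Iio hp
    have ih' : ∀ β < α.pred, chain (HSet (Order.succ 𝔠)) h s β ∈ HSet (Order.succ 𝔠) :=
      fun β hβ => mem_HSet_of_isCountableElementary
        (ih β (hβ.trans_le (Ordinal.pred_le_self α)) (hβ.trans hp)).1
    have H := hull_spec infinite_HSet (X := ZFSet.iUnion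
      (fun β : Set.Iio α => chain (HSet (Order.succ 𝔠)) h s β.1) ∪
      {{s α.pred, h α.pred, ZFSet.range fun β : Set.Iio α.pred =>
        chain (HSet (Order.succ 𝔠)) h s β.1},
      {s α.pred, h α.pred, ZFSet.range fun β : {β : Set.Iio α.pred // ¬ IsEvenOrd β.1} =>
        chain (HSet (Order.succ 𝔠)) h s β.1.1}}) ?_ ?_
    · rw [← chain] at H
      refine ⟨H.1, fun β hβ x hx => H.2 ?_, H.2 ?_, H.2 ?_⟩
      · exact ZFSet.mem_union.2 (.inl (ZFSet.mem_iUnion.2 ⟨⟨β, hβ⟩, hx⟩))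
      · simp
      · simp
    · rw [ZFSet.coe_union, ZFSet.coe_iUnion]
      exact (Set.countable_iUnion fun β => countable_chain _ _ _ _).union
        (countable_insert (countable_singleton _))
    · intro x hx
      rw [ZFSet.mem_union, ZFSet.mem_iUnion, ZFSet.mem_pair] at hx
      rcases hx with ⟨β, hx⟩ | rfl | rfl
      · exact (ih _ β.2 (lt_trans β.2 hα)).1.subset hx
      · refine insert_pair_mem_HSet Cardinal.aleph0_le_continuum (hs _ hp) (hh _ hp)
          (mem_HSet_succ_of_countable Cardinal.aleph0_le_continuum (countable_range _) ?_)
        intro y hy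
        obtain ⟨β, rfl⟩ := ZFSet.mem_range.1 hy
        exact ih' _ β.2
      · refine insert_pair_mem_HSet Cardinal.aleph0_le_continuum (hs _ hp) (hh _ hp)
          (mem_HSet_succ_of_countable Cardinal.aleph0_le_continuum (countable_range _) ?_)
        intro y hy
        obtain ⟨β, rfl⟩ := ZFSet.mem_range.1 hy
        exact ih' _ β.1.2

theorem isModelChain_chain :
    IsModelChain (HSet (Order.succ 𝔠)) h s (chain (HSet (Order.succ 𝔠)) h s) := by
  refine ⟨fun α hα => (chain_spec hh hs hα).1, fun α hα => (chain_spec hh hs hα).2.1,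
    fun α hα => ?_⟩
  have := (chain_spec hh hs (add_one_lt_omega_one hα)).2.2.1
  rwa [Ordinal.pred_add_one] at this

end

/-! ### Guessing along chains of hulls -/

/-- The restriction of `f ∈ 2^{ω₁}` to `α`. -/
def restrict (f : Set.Iio (ω₁ : Ordinal.{u}) → Bool) (α : Set.Iio (ω₁ : Ordinal.{u})) :
    Set.Iio α.1 → Bool :=
  fun β => f ⟨β.1, Set.mem_Iio.2 ((Set.mem_Iio.1 β.2).trans (Set.mem_Iio.1 α.2))⟩

theorem pair_mem_liftRel {A B E a b : ZFSet.{u}} :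
    ZFSet.pair a b ∈ liftRel A B E ↔
      a ∈ countableSubsets A ∧ b ∈ B ∧ ∀ x ∈ a, ZFSet.pair x b ∈ E := by
  rw [liftRel, ZFSet.mem_pairSep]
  constructor
  · rintro ⟨a', ha, b', hb, h, H⟩
    obtain ⟨rfl, rfl⟩ := ZFSet.pair_inj.1 h
    exact ⟨ha, hb, H⟩
  · rintro ⟨ha, hb, H⟩
    exact ⟨a, ha, b, hb, rfl, H⟩

theorem mem_countableSubsets {A a : ZFSet.{u}} :
    a ∈ countableSubsets A ↔ a ⊆ A ∧ (a : Set ZFSet.{u}).Countable := by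
  rw [countableSubsets, ZFSet.mem_sep, ZFSet.mem_powerset]

/-- `dec` decodes every sequence with the property `P` from some `f ∈ 2^{ω₁}`: for club many `α`
the values of the sequence at all `β ≤ α` are decoded from `f ↾ α`. -/
def Decodes (P : (Ordinal.{u} → ZFSet.{u}) → Prop)
    (dec : (α : Ordinal.{u}) → (Set.Iio α → Bool) → Ordinal.{u} → ZFSet.{u}) : Prop :=
  ∀ s, P s → ∃ f : Set.Iio (ω₁ : Ordinal.{u}) → Bool, ∃ C, IsClub C ∧
    ∀ α ∈ C, ∀ β ≤ α.1, dec α.1 (restrict f α) β = s β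

/-- The guesses depend on `h` alone; `s` enters only through the branch `f` that codes it.
Restricting to limit `α` makes the guessed positions even, as the game demands. -/
theorem exists_guess_of_phi {A B E : ZFSet.{u}} (hΦ : Phi (countableSubsets A) B (liftRel A B E))
    {P : (Ordinal.{u} → ZFSet.{u}) → Prop}
    {dec : (α : Ordinal.{u}) → (Set.Iio α → Bool) → Ordinal.{u} → ZFSet.{u}}
    (hP : Decodes P dec) (N : Set ZFSet.{u}) (h : Ordinal.{u} → ZFSet.{u}) :
    ∃ b : Ordinal.{u} → ZFSet.{u}, (∀ α < ω₁, b α ∈ B) ∧ ∀ s, P s →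
      IsStationary {α : Set.Iio (ω₁ : Ordinal.{u}) | Order.IsSuccLimit α.1 ∧
        Captures A E (chain N h s (α.1 + 1)) (b α.1)} := by
  obtain ⟨g, hg, H⟩ := hΦ (fun α t => A ∩ chain N h (dec α t) (α + 1)) fun α _ t => by
    refine mem_countableSubsets.2 ⟨fun x hx => (ZFSet.mem_inter.1 hx).1, ?_⟩
    rw [ZFSet.coe_inter]
    exact (countable_chain _ _ _ _).mono Set.inter_subset_right
  refine ⟨g, hg, fun s hs => ?_⟩
  obtain ⟨f, C, hC, hf⟩ := hP s hs
  refine IsStationary.mono (isStationary_inter_isClub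
    (isStationary_inter_isClub (H f) hC) isClub_isSuccLimit) ?_
  rintro α ⟨⟨hα, hαC⟩, hlim⟩
  refine ⟨hlim, ?_⟩
  rw [← chain_congr (s := dec α.1 (restrict f α)) (by simpa using hf α hαC)]
  exact (pair_mem_liftRel.1 hα).2.2

/-! ### Decoding continuous sequences and sequences of initial segments -/

/-- The set of ordinals with characteristic function `t`. -/
noncomputable def ordSet {α : Ordinal.{u}} (t : Set.Iio α → Bool) : ZFSet.{u} :=
  ZFSet.range fun β : {β : Set.Iio α // t β = true} => β.1.1.toZFSet

theorem toZFSet_mem_ordSet {α : Ordinal.{u}} {t : Set.Iio α → Bool} {β : Ordinal.{u}} :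
    β.toZFSet ∈ ordSet t ↔ ∃ h : β < α, t ⟨β, h⟩ = true := by
  rw [ordSet, ZFSet.mem_range]
  constructor
  · rintro ⟨γ, h⟩
    obtain rfl := Ordinal.toZFSet_injective h
    exact ⟨γ.1.2, γ.2⟩
  · rintro ⟨h, ht⟩
    exact ⟨⟨⟨β, h⟩, ht⟩, rfl⟩

theorem exists_of_mem_ordSet {α : Ordinal.{u}} {t : Set.Iio α → Bool} {x : ZFSet.{u}}
    (hx : x ∈ ordSet t) : ∃ β : Ordinal.{u}, x = β.toZFSet := by
  obtain ⟨β, rfl⟩ := ZFSet.mem_range.1 hx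
  exact ⟨_, rfl⟩

theorem decodes_isInitialSegmentSeq :
    Decodes.{u} IsInitialSegmentSeq fun _ t (β : Ordinal.{u}) =>
    ordSet t ∩ β.toZFSet := by
  classical
  rintro s ⟨X, -, hX⟩
  refine ⟨fun β : Set.Iio (ω₁ : Ordinal.{u}) => decide (β.1.toZFSet ∈ X),
    Set.univ, .univ, fun α _ β hβ => ?_⟩
  rw [hX β (hβ.trans_lt α.2)]
  ext x
  rw [ZFSet.mem_inter, ZFSet.mem_inter, and_congr_left_iff]
  intro hx
  obtain ⟨γ, hγ, rfl⟩ := Ordinal.mem_toZFSet_iff.1 hx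
  rw [toZFSet_mem_ordSet]
  simp [restrict, hγ.trans_le hβ]

open Classical in
/-- The continuous sequence whose value at a nonlimit ordinal `β` is decoded by `D` from the values
of `t` in the interval `[ω * β, ω * β + ω)`. -/
noncomputable def decodeSeq (D : (ℕ → Bool) → ZFSet.{u}) {α : Ordinal.{u}} (t : Set.Iio α → Bool)
    (β : Ordinal.{u}) : ZFSet.{u} :=
  if Order.IsSuccLimit β then ZFSet.range fun γ : Set.Iio β => decodeSeq D t γ.1
  else D fun n => if h : ω * β + n < α then t ⟨ω * β + n, h⟩ else false
termination_by β
decreasing_by exact γ.2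

theorem isClub_omega0_mul : IsClub {α : Set.Iio (ω₁ : Ordinal.{u}) |
    0 < α.1 ∧ ∀ β < α.1, ω * β + ω < α.1} := by
  refine isClub_closurePoints (G := fun β => ω * β + ω) (fun a b h => by dsimp only; gcongr)
    fun β hβ => ?_
  rw [← Cardinal.ord_aleph, Cardinal.lt_ord, ← Cardinal.succ_aleph0, Order.lt_succ_iff] at hβ ⊢
  rw [Ordinal.card_add, Ordinal.card_mul, Ordinal.card_omega0]
  exact (add_le_add (mul_le_mul' le_rfl hβ) le_rfl).trans (by simp)

/-- If `α` is closed under `β ↦ ω * β + ω`, then `f ↾ α` contains the real of every `β < α`. The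
value at `α` itself is not coded below `α`, but `α` is a limit, so continuity determines it. -/
theorem decodes_isContinuousSeq {D : (ℕ → Bool) → ZFSet.{u}}
    (hD : ∀ x ∈ HSet.{u} ℵ₁, ∃ r, D r = x) :
    Decodes IsContinuousSeq fun _ t => decodeSeq D t := by
  classical
  rintro s ⟨hs, hlim⟩
  have hr : ∀ β, ∃ r, β < ω₁ → D r = s β := fun β => by
    by_cases hβ : β < ω₁
    · exact (hD _ (hs β hβ)).imp fun _ h _ => h
    · exact ⟨fun _ => false, fun h => absurd h hβ⟩
  choose r hr using hr
  -- At `δ = ω * β + n` the branch has the `n`-th digit of the real coding `s β`.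
  refine ⟨fun δ => decide (∃ n : ℕ, δ.1 % ω = n ∧ r (δ.1 / ω) n = true), _, isClub_omega0_mul,
    fun α hα β hβ => ?_⟩
  have hαlim : Order.IsSuccLimit α.1 := isSuccLimit_of_closed hα.1 fun β hβ =>
    (add_le_add (Ordinal.le_mul_right β Ordinal.omega0_pos)
      (Ordinal.one_lt_omega0).le).trans_lt (hα.2 β hβ)
  dsimp only
  induction β using WellFoundedLT.induction with
  | _ β ih =>
    rw [decodeSeq]
    split_ifs with h
    · rw [hlim β (hβ.trans_lt α.2) h]
      congr 1
      exact funext fun γ => ih _ γ.2 (γ.2.le.trans hβ)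
    · have hβ' : β < α.1 := hβ.lt_of_ne fun e => h (e ▸ hαlim)
      rw [← hr β (hβ.trans_lt α.2)]
      congr 1
      funext n
      have hn : ω * β + n < α.1 :=
        (add_le_add le_rfl (Ordinal.natCast_lt_omega0 n).le).trans_lt (hα.2 β hβ')
      rw [dif_pos hn]
      have h1 : (ω * β + n) % ω = (n : Ordinal.{u}) := by
        rw [Ordinal.mul_add_mod_self, Ordinal.mod_eq_of_lt (Ordinal.natCast_lt_omega0 n)]
      have h2 : (ω * β + n) / ω = β := by
        rw [Ordinal.mul_add_div _ Ordinal.omega0_ne_zero,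
          Ordinal.div_eq_zero_of_lt (Ordinal.natCast_lt_omega0 n), add_zero]
      simp [restrict, h1, h2]

/-! ### Even and odd ordinals -/

theorem isEvenOrd_or (α : Ordinal.{u}) : IsEvenOrd α ∨ ∃ γ, IsEvenOrd γ ∧ α = γ + 1 := by
  have h : α % 2 < 2 := Ordinal.mod_lt _ two_ne_zero
  rw [← one_add_one_eq_two, Order.lt_add_one_iff, Order.le_one_iff] at h
  have e := Ordinal.div_add_mod α 2
  rw [one_add_one_eq_two] at h
  rcases h with h | h
  · exact .inl ⟨α / 2, by rw [← e]; simp [h]⟩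
  · exact .inr ⟨2 * (α / 2), ⟨_, rfl⟩, by rw [h] at e; exact e.symm⟩

theorem IsEvenOrd.not_add_one {α : Ordinal.{u}} (h : IsEvenOrd α) : ¬ IsEvenOrd (α + 1) := by
  rintro ⟨δ, hδ⟩
  obtain ⟨γ, rfl⟩ := h
  have h1 := congrArg (· % (2 : Ordinal.{u})) hδ
  simp only [Ordinal.mul_add_mod_self, Ordinal.mul_mod, Ordinal.mod_eq_of_lt one_lt_two] at h1
  exact one_ne_zero h1

theorem IsEvenOrd.add_two {α : Ordinal.{u}} (h : IsEvenOrd α) : IsEvenOrd (α + 1 + 1) := by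
  obtain ⟨γ, rfl⟩ := h
  exact ⟨γ + 1, by rw [mul_add, mul_one, add_assoc, one_add_one_eq_two]⟩

theorem isEvenOrd_of_isSuccLimit {α : Ordinal.{u}} (h : Order.IsSuccLimit α) : IsEvenOrd α := by
  obtain h' | ⟨γ, -, rfl⟩ := isEvenOrd_or α
  · exact h'
  · exact absurd h (by simp)

theorem isEvenOrd_zero : IsEvenOrd (0 : Ordinal.{u}) := ⟨0, by simp⟩

theorem exists_isEvenOrd_gt {α γ : Ordinal.{u}} (hα : Order.IsSuccLimit α) (hγ : γ < α) :
    ∃ β, γ < β ∧ β < α ∧ IsEvenOrd β ∧ ¬ Order.IsSuccLimit β := by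
  have h1 := hα.add_one_lt hγ
  have h2 := hα.add_one_lt h1
  obtain h | ⟨δ, hδ, rfl⟩ := isEvenOrd_or γ
  · exact ⟨γ + 1 + 1, (lt_add_one _).trans (lt_add_one _), h2, h.add_two, by simp⟩
  · exact ⟨δ + 1 + 1, lt_add_one _, h1, hδ.add_two, by simp⟩

/-! ### Diamonds from `Φ` -/

variable {A B E : ZFSet.{u}}

theorem diamondELFor_of_phi (hΦ : Phi (countableSubsets A) B (liftRel A B E))
    {P : (Ordinal.{u} → ZFSet.{u}) → Prop}
    {dec : (α : Ordinal.{u}) → (Set.Iio α → Bool) → Ordinal.{u} → ZFSet.{u}}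
    (hP : Decodes P dec) (hP' : ∀ s, P s → ∀ α < ω₁, s α ∈ HSet (Order.succ 𝔠)) :
    DiamondELFor P A B E (HSet (Order.succ 𝔠)) := by
  intro h hh
  obtain ⟨b, hb, H⟩ := exists_guess_of_phi hΦ hP (HSet (Order.succ 𝔠)) h
  exact ⟨b, hb, fun s hs => ⟨_, isModelChain_chain hh (hP' s hs),
    (H s hs).mono fun _ hα => hα.2⟩⟩

theorem diamondEL_of_phi (hΦ : Phi (countableSubsets A) B (liftRel A B E)) :
    DiamondEL A B E (HSet (Order.succ 𝔠)) := by
  obtain ⟨D, hD⟩ := exists_real_coding.{u}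
  exact diamondELFor_of_phi hΦ (decodes_isContinuousSeq hD)
    fun s hs α hα => HSet_aleph_one_subset (hs.1 α hα)

theorem diamondELInitial_of_phi (hΦ : Phi (countableSubsets A) B (liftRel A B E)) :
    DiamondELInitial A B E (HSet (Order.succ 𝔠)) := by
  refine diamondELFor_of_phi hΦ decodes_isInitialSegmentSeq ?_
  rintro s ⟨X, -, hX⟩ α hα
  rw [hX α hα]
  have hsub : X ∩ α.toZFSet ⊆ α.toZFSet := fun x hx => (ZFSet.mem_inter.1 hx).2
  exact HSet_aleph_one_subset (mem_HSet_aleph_one_of_countable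
    ((countable_toZFSet hα).mono hsub)
    fun x hx => mem_HSet_of_mem (toZFSet_mem_HSet hα) (hsub hx))

open Classical in
/-- The largest even ordinal `≤ α`. -/
noncomputable def evenPart (α : Ordinal.{u}) : Ordinal.{u} :=
  if IsEvenOrd α then α else α.pred

theorem evenPart_le (α : Ordinal.{u}) : evenPart α ≤ α := by
  unfold evenPart
  split_ifs
  · exact le_rfl
  · exact Ordinal.pred_le_self α

theorem IsEvenOrd.evenPart_eq {α : Ordinal.{u}} (h : IsEvenOrd α) : evenPart α = α :=
  if_pos h

theorem IsEvenOrd.evenPart_add_one {α : Ordinal.{u}} (h : IsEvenOrd α) :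
    evenPart (α + 1) = α := by
  rw [evenPart, if_neg h.not_add_one, Ordinal.pred_add_one]

theorem isEvenOrd_evenPart (α : Ordinal.{u}) : IsEvenOrd (evenPart α) := by
  obtain h | ⟨γ, h, rfl⟩ := isEvenOrd_or α
  · rwa [h.evenPart_eq]
  · rwa [h.evenPart_add_one]

/-- Repeating each even move at the following odd ordinal adds no new values, so the game's limit
rule becomes continuity. -/
theorem isContinuousSeq_of_badLegal {x : Ordinal.{u} → ZFSet.{u}} (hx : BadLegal x) :
    IsContinuousSeq fun α => x (evenPart α) := by
  refine ⟨fun α hα => (hx _ ((evenPart_le α).trans_lt hα) (isEvenOrd_evenPart α)).1,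
    fun α hα hlim => ?_⟩
  have he := isEvenOrd_of_isSuccLimit hlim
  dsimp only
  rw [he.evenPart_eq, (hx α hα he).2 hlim]
  ext y
  rw [ZFSet.mem_range, ZFSet.mem_range]
  constructor
  · rintro ⟨β, rfl⟩
    exact ⟨β.1, by rw [β.2.evenPart_eq]⟩
  · rintro ⟨β, rfl⟩
    exact ⟨⟨⟨_, (evenPart_le β.1).trans_lt β.2⟩, isEvenOrd_evenPart _⟩, rfl⟩

open Classical in
/-- GOOD answers with the chain of hulls along the even moves made so far. -/
noncomputable def chainStrategy (N : Set ZFSet.{u}) (h : Ordinal.{u} → ZFSet.{u}) :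
    Strategy.{u} := fun α p =>
  -- The model with index `α + 1` uses only arguments `β ≤ α`, so the default `∅` never matters.
  chain N h (fun β => if hβ : evenPart β ≤ α then p ⟨evenPart β, hβ⟩ else ∅) (α + 1)

theorem chainStrategy_follows {N : Set ZFSet.{u}} {h x : Ordinal.{u} → ZFSet.{u}}
    (hx : (chainStrategy N h).Follows x) {α : Ordinal.{u}} (hα : α < ω₁) (he : IsEvenOrd α) :
    x (α + 1) = chain N h (fun β => x (evenPart β)) (α + 1) := by
  rw [hx α hα he]
  refine chain_congr fun β hβ => ?_
  rw [Ordinal.pred_add_one] at hβ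
  rw [dif_pos ((evenPart_le β).trans hβ)]

theorem diamondSTR_of_phi (hΦ : Phi (countableSubsets A) B (liftRel A B E)) :
    DiamondSTR A B E (HSet (Order.succ 𝔠)) := by
  intro h hh
  obtain ⟨D, hD⟩ := exists_real_coding.{u}
  obtain ⟨b, hb, H⟩ := exists_guess_of_phi hΦ (decodes_isContinuousSeq hD)
    (HSet (Order.succ 𝔠)) h
  refine ⟨b, hb, chainStrategy (HSet (Order.succ 𝔠)) h, fun x hbad hx => ?_⟩
  have hs := isContinuousSeq_of_badLegal hbad
  have hsN : ∀ α < ω₁, x (evenPart α) ∈ HSet (Order.succ 𝔠) := fun α hα =>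
    HSet_aleph_one_subset (hs.1 α hα)
  refine ⟨fun α hα he => ?_, (H _ hs).mono fun α hα => ?_⟩
  · have spec := chain_spec hh hsN (add_one_lt_omega_one hα)
    rw [chainStrategy_follows hx hα he]
    refine ⟨spec.1, ?_⟩
    have hm := spec.2.2.2
    rw [Ordinal.pred_add_one, he.evenPart_eq] at hm
    -- It remains to see that GOOD's earlier moves are the models of the chain for the whole play.
    convert hm using 6 with β
    obtain h' | ⟨γ, hγ, e⟩ := isEvenOrd_or β.1.1
    · exact absurd h' β.2
    · rw [e]
      refine chainStrategy_follows hx (lt_of_le_of_lt ?_ hα) hγ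
      exact (lt_add_one γ).le.trans (e ▸ (Set.mem_Iio.1 β.1.2).le)
  · have he := isEvenOrd_of_isSuccLimit hα.1
    refine ⟨he, ?_⟩
    rw [chainStrategy_follows hx α.2 he]
    exact hα.2

/-! ### Closure properties of countable elementary submodels -/

section Elementary

open FirstOrder FirstOrder.Language

@[simp]
theorem relMap_mem {N : Set ZFSet.{u}} (v : Fin 2 → N) :
    Structure.RelMap (L := setLang) MemSymbol.mem v ↔ (v 0 : ZFSet.{u}) ∈ (v 1 : ZFSet.{u}) :=
  Iff.rfl

/-- The form of elementarity behind the closure properties below: witnesses are exhibited in `N`,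
reflected to `M`, and then identified using the transitivity of `H(κ)`. -/
theorem IsCountableElementary.exists_realize {M : ZFSet.{u}} {N : Set ZFSet.{u}}
    (hM : IsCountableElementary M N) {k m : ℕ} (φ : setLang.BoundedFormula (Fin k) m)
    (v : Fin k → N) (hv : ∀ i, (v i : ZFSet.{u}) ∈ M) (h : ∃ xs : Fin m → N, φ.Realize v xs) :
    ∃ xs : Fin m → N, (∀ i, (xs i : ZFSet.{u}) ∈ M) ∧ φ.Realize v xs := by
  obtain ⟨-, S, hS⟩ := hM
  have hv' : ∀ i, v i ∈ S := fun i => ((hS _).1 (hv i)).2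
  let w : Fin k → S := fun i => ⟨v i, hv' i⟩
  have e : S.subtype ∘ w = v := rfl
  have h1 : φ.exs.Realize v := BoundedFormula.realize_exs.2 h
  rw [← e, S.subtype.map_formula] at h1
  obtain ⟨xs, hxs⟩ := BoundedFormula.realize_exs.1 h1
  rw [← S.subtype.map_boundedFormula, e] at hxs
  exact ⟨_, fun i => (hS _).2 ⟨(xs i).1.2, (xs i).2⟩, hxs⟩

/-- `t₁ ∈ t₂` as a formula. -/
def memFormula {α : Type} {n : ℕ} (t₁ t₂ : setLang.Term (α ⊕ Fin n)) :
    setLang.BoundedFormula α n :=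
  Relations.boundedFormula₂ (L := setLang) (MemSymbol.mem : setLang.Relations 2) t₁ t₂

@[simp]
theorem realize_memFormula {N : Set ZFSet.{u}} {α : Type} {n : ℕ}
    (t₁ t₂ : setLang.Term (α ⊕ Fin n)) (v : α → N) (xs : Fin n → N) :
    (memFormula t₁ t₂).Realize v xs ↔
      ((t₁.realize (Sum.elim v xs) : N) : ZFSet.{u}) ∈
        ((t₂.realize (Sum.elim v xs) : N) : ZFSet.{u}) := by
  exact BoundedFormula.realize_rel₂.trans (relMap_mem _)

variable {κ : Cardinal.{u}} {M : ZFSet.{u}}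

/-- It is reflected that three sets cover all elements of the triple; three such sets in `M` must
include `a`, `b` and `c`. -/
theorem IsCountableElementary.triple_subset (hM : IsCountableElementary M (HSet κ))
    {a b c : ZFSet.{u}} (h : {a, b, c} ∈ M) : a ∈ M ∧ b ∈ M ∧ c ∈ M := by
  have hN := hM.subset h
  have ha : a ∈ HSet κ := mem_HSet_of_mem hN (by simp)
  have hb : b ∈ HSet κ := mem_HSet_of_mem hN (by simp)
  have hc : c ∈ HSet κ := mem_HSet_of_mem hN (by simp)
  let φ : setLang.BoundedFormula (Fin 1) 3 :=
    (memFormula (&3) (Term.var (Sum.inl 0)) ⟹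
      (Term.bdEqual (&3) (&0) ⊔ (Term.bdEqual (&3) (&1) ⊔ Term.bdEqual (&3) (&2)))).all
  have key : ∀ (v : Fin 1 → HSet κ) (xs : Fin 3 → HSet κ), φ.Realize v xs ↔
      ∀ w : HSet κ, w.1 ∈ (v 0).1 → w = xs 0 ∨ w = xs 1 ∨ w = xs 2 := fun v xs => by
    simp [φ, Fin.snoc]
    rfl
  obtain ⟨xs, hxs, H⟩ := hM.exists_realize φ (fun _ => ⟨_, hN⟩) (fun _ => h)
    ⟨![⟨a, ha⟩, ⟨b, hb⟩, ⟨c, hc⟩], (key _ _).2 fun w hw => by simpa [Subtype.ext_iff] using hw⟩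
  have H' : ∀ w (hw : w ∈ HSet κ), w ∈ ({a, b, c} : ZFSet.{u}) → w ∈ M := fun w hw hw' => by
    rcases (key _ _).1 H ⟨w, hw⟩ hw' with e | e | e
    all_goals
      have := congrArg Subtype.val e
      dsimp only at this
      rw [this]
      exact hxs _
  exact ⟨H' a ha (by simp), H' b hb (by simp), H' c hc (by simp)⟩

theorem IsCountableElementary.unordered_pair_mem (hκ : ℵ₀ ≤ κ)
    (hM : IsCountableElementary M (HSet (Order.succ κ))) {a b : ZFSet.{u}} (ha : a ∈ M)
    (hb : b ∈ M) : {a, b} ∈ M := by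
  have hab := unordered_pair_mem_HSet hκ (hM.subset ha) (hM.subset hb)
  let φ : setLang.BoundedFormula (Fin 2) 1 :=
    ((memFormula (&1) (&0)).iff
      (Term.bdEqual (&1) (Term.var (Sum.inl 0)) ⊔ Term.bdEqual (&1) (Term.var (Sum.inl 1)))).all
  have key : ∀ (v : Fin 2 → HSet (Order.succ κ)) (xs : Fin 1 → HSet (Order.succ κ)),
      φ.Realize v xs ↔
      ∀ w : HSet (Order.succ κ), w.1 ∈ (xs 0).1 ↔ w = v 0 ∨ w = v 1 := fun v xs => by
    simp [φ, Fin.snoc]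
  obtain ⟨xs, hxs, H⟩ := hM.exists_realize φ ![⟨a, hM.subset ha⟩, ⟨b, hM.subset hb⟩]
    (by simp [Fin.forall_fin_two, ha, hb])
    ⟨fun _ => ⟨_, hab⟩, (key _ _).2 fun w => by simp [Subtype.ext_iff]⟩
  rw [key] at H
  have e : ({a, b} : ZFSet.{u}) = (xs 0).1 := by
    ext w
    rw [ZFSet.mem_pair]
    constructor
    · intro hw
      have hw' : w ∈ HSet (Order.succ κ) := by
        rcases hw with rfl | rfl
        exacts [hM.subset ha, hM.subset hb]
      exact (H ⟨w, hw'⟩).2 (by simpa [Subtype.ext_iff] using hw)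
    · intro hw
      simpa [Subtype.ext_iff] using (H ⟨w, mem_HSet_of_mem (xs 0).2 hw⟩).1 hw
  exact e ▸ hxs 0

theorem IsCountableElementary.singleton_mem (hκ : ℵ₀ ≤ κ)
    (hM : IsCountableElementary M (HSet (Order.succ κ))) {a : ZFSet.{u}} (ha : a ∈ M) :
    {a} ∈ M := by
  simpa using hM.unordered_pair_mem hκ ha ha

theorem IsCountableElementary.pair_mem (hκ : ℵ₀ ≤ κ)
    (hM : IsCountableElementary M (HSet (Order.succ κ))) {a b : ZFSet.{u}} (ha : a ∈ M)
    (hb : b ∈ M) : ZFSet.pair a b ∈ M :=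
  hM.unordered_pair_mem hκ (hM.singleton_mem hκ ha) (hM.unordered_pair_mem hκ ha hb)

theorem IsCountableElementary.exists_mem_mem (hM : IsCountableElementary M (HSet κ))
    {a h q : ZFSet.{u}} (ha : a ∈ M) (hh : h ∈ M) (hq : q ∈ h) (haq : a ∈ q) :
    ∃ q ∈ M, q ∈ h ∧ a ∈ q := by
  let φ : setLang.BoundedFormula (Fin 2) 1 :=
    memFormula (&0) (Term.var (Sum.inl 1)) ⊓ memFormula (Term.var (Sum.inl 0)) (&0)
  have key : ∀ (v : Fin 2 → HSet κ) (xs : Fin 1 → HSet κ),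
      φ.Realize v xs ↔ (xs 0).1 ∈ (v 1).1 ∧ (v 0).1 ∈ (xs 0).1 := fun v xs => by
    simp [φ]
  obtain ⟨xs, hxs, H⟩ := hM.exists_realize φ ![⟨a, hM.subset ha⟩, ⟨h, hM.subset hh⟩]
    (by simp [Fin.forall_fin_two, ha, hh])
    ⟨fun _ => ⟨_, mem_HSet_of_mem (hM.subset hh) hq⟩, (key _ _).2 ⟨hq, haq⟩⟩
  exact ⟨_, hxs 0, (key _ _).1 H⟩

/-- Countable elementary submodels are closed under the functions that they contain. -/
theorem IsCountableElementary.apply_mem (hκ : ℵ₀ ≤ κ)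
    (hM : IsCountableElementary M (HSet (Order.succ κ))) {h p e : ZFSet.{u}} (hh : h ∈ M)
    (hp : p ∈ M) (hpe : ZFSet.pair p e ∈ h) (hpair : ∀ q ∈ h, ∃ x y, q = ZFSet.pair x y)
    (huniq : ∀ e', ZFSet.pair p e' ∈ h → e' = e) : e ∈ M := by
  obtain ⟨q, hqM, hqh, hpq⟩ := hM.exists_mem_mem (hM.singleton_mem hκ hp) hh hpe
    (by simp [ZFSet.pair])
  obtain ⟨x, y, rfl⟩ := hpair q hqh
  obtain rfl : p = x := by
    rw [ZFSet.pair, ZFSet.mem_pair, ZFSet.singleton_inj, ZFSet.singleton_eq_pair_iff] at hpq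
    rcases hpq with rfl | ⟨rfl, -⟩ <;> rfl
  obtain rfl := huniq y hqh
  -- Pairs are written as triples with a repetition, so that `triple_subset` unpacks them.
  have h1 : ({{p}, {p, y}, {p, y}} : ZFSet.{u}) ∈ M := by
    rw [ZFSet.pair_eq_singleton]
    exact hqM
  have h2 : ({p, y, y} : ZFSet.{u}) ∈ M := by
    rw [ZFSet.pair_eq_singleton]
    exact (hM.triple_subset h1).2.1
  exact (hM.triple_subset h2).2.1

end Elementary

/-! ### `Φ` from diamonds -/

/-- The ranks increase strictly. The `n`-fold singleton of `c` thus serves as the number `n`, and a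
model containing `c` contains it by closure under singletons. -/
theorem iterate_singleton_injective (c : ZFSet.{u}) :
    Function.Injective fun n : ℕ => (singleton : ZFSet.{u} → ZFSet.{u})^[n] c := by
  have : StrictMono fun n : ℕ => ((singleton : ZFSet.{u} → ZFSet.{u})^[n] c).rank :=
    strictMono_nat_of_lt_succ fun n => by
      rw [Function.iterate_succ_apply', ZFSet.rank_singleton]
      exact Order.lt_succ _
  exact fun m n h => this.injective (congrArg ZFSet.rank h)

/-- The graph of the function that sends the code of `t` and a number `n` to `e t n`. -/
noncomputable def codeGraph {α : Ordinal.{u}} (c : (Set.Iio α → Bool) → ZFSet.{u})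
    (e : (Set.Iio α → Bool) → ℕ → ZFSet.{u}) : ZFSet.{u} :=
  ZFSet.range fun p : (Set.Iio α → Bool) × ℕ =>
    ZFSet.pair (ZFSet.pair (c p.1) (singleton^[p.2] (c p.1))) (e p.1 p.2)

theorem iterate_singleton_mem_HSet {κ : Cardinal.{u}} (hκ : ℵ₀ ≤ κ) {c : ZFSet.{u}}
    (hc : c ∈ HSet (Order.succ κ)) (n : ℕ) : singleton^[n] c ∈ HSet (Order.succ κ) := by
  induction n with
  | zero => exact hc
  | succ n ih =>
    rw [Function.iterate_succ_apply']
    exact singleton_mem_HSet hκ ih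

/-- For countable `α` the graph has at most `2 ^ ℵ₀ * ℵ₀ = 𝔠` elements; this is why `H(𝔠⁺)` is the
right structure. -/
theorem codeGraph_mem_HSet {α : Ordinal.{u}} (hα : α < ω₁)
    {c : (Set.Iio α → Bool) → ZFSet.{u}} {e : (Set.Iio α → Bool) → ℕ → ZFSet.{u}}
    (hc : ∀ t, c t ∈ HSet (Order.succ 𝔠)) (he : ∀ t n, e t n ∈ HSet (Order.succ 𝔠)) :
    codeGraph c e ∈ HSet (Order.succ 𝔠) := by
  have h𝔠 := Cardinal.aleph0_le_continuum.{u}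
  refine mem_HSet_succ_of_forall_mem h𝔠 ?_ fun x hx => ?_
  · rw [← Cardinal.lift_le.{u + 1}]
    refine ZFSet.lift_card_range_le.trans ?_
    have h1 : #(Set.Iio α) ≤ ℵ₀ := Cardinal.mk_le_aleph0_iff.2 (countable_Iio hα)
    have h2 : #(Set.Iio α → Bool) ≤ 𝔠 := by
      simpa using Cardinal.power_le_power_left two_ne_zero h1
    simpa using mul_le_mul' h2 Cardinal.aleph0_le_continuum.{u + 1}
  · obtain ⟨p, rfl⟩ := ZFSet.mem_range.1 hx
    exact pair_mem_HSet h𝔠 (pair_mem_HSet h𝔠 (hc _) (iterate_singleton_mem_HSet h𝔠 (hc _) _))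
      (he _ _)

theorem IsCountableElementary.codeGraph_apply_mem {κ : Cardinal.{u}} (hκ : ℵ₀ ≤ κ) {M : ZFSet.{u}}
    (hM : IsCountableElementary M (HSet (Order.succ κ))) {α : Ordinal.{u}}
    {c : (Set.Iio α → Bool) → ZFSet.{u}} (hc : Function.Injective c)
    {e : (Set.Iio α → Bool) → ℕ → ZFSet.{u}} (hce : codeGraph c e ∈ M) {t : Set.Iio α → Bool}
    (ht : c t ∈ M) (n : ℕ) : e t n ∈ M := by
  have hn : ∀ n, singleton^[n] (c t) ∈ M := fun n => by
    induction n with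
    | zero => exact ht
    | succ n ih =>
      rw [Function.iterate_succ_apply']
      exact hM.singleton_mem hκ ih
  refine hM.apply_mem hκ hce (hM.pair_mem hκ ht (hn n)) (ZFSet.mem_range.2 ⟨(t, n), rfl⟩) ?_ ?_
  · intro q hq
    obtain ⟨p, rfl⟩ := ZFSet.mem_range.1 hq
    exact ⟨_, _, rfl⟩
  · intro e' he'
    obtain ⟨⟨t', m⟩, hp⟩ := ZFSet.mem_range.1 he'
    rw [ZFSet.pair_inj, ZFSet.pair_inj] at hp
    obtain ⟨⟨h1, h2⟩, rfl⟩ := hp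
    obtain rfl := hc h1
    obtain rfl := iterate_singleton_injective _ h2
    rfl

variable {A B E : ZFSet.{u}}

/-- If for injective codes `c α` of the elements of `2^α` there are always enough elementary
submodels that contain the codes of the restrictions of a given `f ∈ 2^{ω₁}`, then `Φ` holds. -/
theorem phi_of_codes (hA : A ∈ HSet (Order.succ 𝔠))
    {c : (α : Ordinal.{u}) → (Set.Iio α → Bool) → ZFSet.{u}}
    (hc : ∀ α < ω₁, ∀ t, c α t ∈ HSet ℵ₁)
    (hinj : ∀ α, Order.IsSuccLimit α → Function.Injective (c α))
    (H : ∀ h : Ordinal.{u} → ZFSet.{u}, (∀ α < ω₁, h α ∈ HSet (Order.succ 𝔠)) →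
      ∃ b : Ordinal.{u} → ZFSet.{u}, (∀ α < ω₁, b α ∈ B) ∧
        ∀ f : Set.Iio (ω₁ : Ordinal.{u}) → Bool, ∃ M : Ordinal.{u} → ZFSet.{u},
          (∀ α : Set.Iio (ω₁ : Ordinal.{u}), Order.IsSuccLimit α.1 →
            IsCountableElementary (M α.1) (HSet (Order.succ 𝔠)) ∧
              ∃ z, {c α.1 (restrict f α), h α.1, z} ∈ M α.1) ∧
          IsStationary {α : Set.Iio (ω₁ : Ordinal.{u}) | Captures A E (M α.1) (b α.1)}) :
    Phi (countableSubsets A) B (liftRel A B E) := by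
  intro F hF
  have he : ∀ (α : Ordinal.{u}) (t : Set.Iio α → Bool), ∃ e : ℕ → ZFSet.{u}, α < ω₁ →
      (∀ n, e n ∈ HSet (Order.succ 𝔠)) ∧ ∀ x ∈ F α t, ∃ n, e n = x := fun α t => by
    by_cases hα : α < ω₁
    · obtain ⟨hsub, hcount⟩ := mem_countableSubsets.1 (hF α hα t)
      -- `F α t` may be empty; adding `A`, itself an element of `H(𝔠⁺)`, allows an enumeration by
      -- `ℕ`.
      obtain ⟨e, he⟩ := (hcount.insert A).exists_eq_range (Set.insert_nonempty _ _)
      refine ⟨e, fun _ => ⟨fun n => ?_, fun x hx => ?_⟩⟩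
      · have : e n ∈ insert A (F α t : Set ZFSet.{u}) := he ▸ Set.mem_range_self n
        rcases this with h | h
        · rwa [h]
        · exact mem_HSet_of_mem hA (hsub h)
      · have : x ∈ insert A (F α t : Set ZFSet.{u}) := Set.mem_insert_of_mem _ hx
        rwa [he] at this
    · exact ⟨fun _ => ∅, fun h => absurd h hα⟩
  choose e he using he
  obtain ⟨b, hb, Hb⟩ := H (fun α => codeGraph (c α) (e α)) fun α hα => codeGraph_mem_HSet hα
    (fun t => HSet_aleph_one_subset (hc α hα t)) fun t n => (he α t hα).1 n
  refine ⟨b, hb, fun f => ?_⟩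
  obtain ⟨M, hM, hstat⟩ := Hb f
  refine IsStationary.mono (isStationary_inter_isClub hstat isClub_isSuccLimit) ?_
  rintro α ⟨hα, hlim⟩
  obtain ⟨hMα, z, hz⟩ := hM α hlim
  obtain ⟨hct, hh, -⟩ := hMα.triple_subset hz
  refine pair_mem_liftRel.2 ⟨hF α.1 α.2 _, hb α.1 α.2, fun x hx => hα x ?_⟩
  refine ZFSet.mem_inter.2 ⟨(mem_countableSubsets.1 (hF α.1 α.2 _)).1 hx, ?_⟩
  obtain ⟨n, rfl⟩ := (he α.1 _ α.2).2 x hx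
  exact hMα.codeGraph_apply_mem Cardinal.aleph0_le_continuum (hinj _ hlim) hh hct n

open Classical in
/-- The codes of the restrictions of `f ∈ 2^{ω₁}`. -/
noncomputable def codeSeq (c : (α : Ordinal.{u}) → (Set.Iio α → Bool) → ZFSet.{u})
    (f : Set.Iio (ω₁ : Ordinal.{u}) → Bool) (α : Ordinal.{u}) : ZFSet.{u} :=
  if h : α < ω₁ then c α (restrict f ⟨α, h⟩) else ∅

theorem codeSeq_eq (c : (α : Ordinal.{u}) → (Set.Iio α → Bool) → ZFSet.{u})
    (f : Set.Iio (ω₁ : Ordinal.{u}) → Bool) {α : Ordinal.{u}} (h : α < ω₁) :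
    codeSeq c f α = c α (restrict f ⟨α, h⟩) :=
  dif_pos h

theorem phi_of_diamondELFor (hA : A ∈ HSet (Order.succ 𝔠))
    {c : (α : Ordinal.{u}) → (Set.Iio α → Bool) → ZFSet.{u}}
    (hc : ∀ α < ω₁, ∀ t, c α t ∈ HSet ℵ₁)
    (hinj : ∀ α, Order.IsSuccLimit α → Function.Injective (c α))
    {P : (Ordinal.{u} → ZFSet.{u}) → Prop} (hP : ∀ f, P (codeSeq c f))
    (hD : DiamondELFor P A B E (HSet (Order.succ 𝔠))) :
    Phi (countableSubsets A) B (liftRel A B E) := by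
  refine phi_of_codes hA hc hinj fun h hh => ?_
  obtain ⟨b, hb, Hb⟩ := hD h hh
  refine ⟨b, hb, fun f => ?_⟩
  obtain ⟨M, ⟨hM1, -, hM3⟩, hM⟩ := Hb _ (hP f)
  -- The shift selects the model that contains the parameters of step `α`.
  refine ⟨fun α => M (α + 1), fun α _ => ⟨hM1 _ (add_one_lt_omega_one α.2), ?_⟩, hM⟩
  have h3 := hM3 α.1 α.2
  rw [codeSeq_eq c f α.2] at h3
  exact ⟨_, h3⟩

theorem ordSet_injective {α : Ordinal.{u}} :
    Function.Injective (ordSet : (Set.Iio α → Bool) → ZFSet.{u}) := fun t t' h => by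
  funext β
  have h1 := toZFSet_mem_ordSet (t := t) (β := β.1)
  rw [h, toZFSet_mem_ordSet] at h1
  have h2 : β.1 < α := β.2
  simp only [h2, exists_true_left] at h1
  exact Bool.eq_iff_iff.2 h1.symm

theorem ordSet_mem_HSet {α : Ordinal.{u}} (hα : α < ω₁) (t : Set.Iio α → Bool) :
    ordSet t ∈ HSet ℵ₁ := by
  have := countable_Iio hα
  refine mem_HSet_aleph_one_of_countable (countable_range _) fun x hx => ?_
  obtain ⟨β, rfl⟩ := ZFSet.mem_range.1 hx
  exact toZFSet_mem_HSet (lt_trans β.1.2 hα)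

theorem phi_of_diamondELInitial (hA : A ∈ HSet (Order.succ 𝔠))
    (hD : DiamondELInitial A B E (HSet (Order.succ 𝔠))) :
    Phi (countableSubsets A) B (liftRel A B E) := by
  refine phi_of_diamondELFor hA (c := fun _ t => ordSet t) (fun α hα => ordSet_mem_HSet hα)
    (fun _ _ => ordSet_injective) (fun f => ⟨ordSet f, fun x hx => ?_, fun α hα => ?_⟩) hD
  · obtain ⟨β, rfl⟩ := ZFSet.mem_range.1 hx
    exact Ordinal.toZFSet_mem_toZFSet_iff.2 β.1.2
  · rw [codeSeq_eq _ _ hα]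
    ext x
    rw [ZFSet.mem_inter, Ordinal.mem_toZFSet_iff]
    constructor
    · intro hx
      obtain ⟨β, rfl⟩ := exists_of_mem_ordSet hx
      obtain ⟨hβ, h⟩ := toZFSet_mem_ordSet.1 hx
      exact ⟨toZFSet_mem_ordSet.2 ⟨hβ.trans hα, h⟩, β, hβ, rfl⟩
    · rintro ⟨hx, β, hβ, rfl⟩
      obtain ⟨_, h⟩ := toZFSet_mem_ordSet.1 hx
      exact toZFSet_mem_ordSet.2 ⟨hβ, h⟩

/-- The restriction of `t ∈ 2^α` to `β`. -/
def truncate {α β : Ordinal.{u}} (h : β < α) (t : Set.Iio α → Bool) : Set.Iio β → Bool :=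
  fun γ => t ⟨γ.1, Set.mem_Iio.2 (lt_trans (Set.mem_Iio.1 γ.2) h)⟩

open Classical in
/-- Codes `c α t` of the elements `t` of `2^α`, such that for limit `α` the code `c α t` is the set
of the codes `c β (t ↾ β)` for the `β < α` that satisfy `J`. -/
noncomputable def limitCode (J : Ordinal.{u} → Prop) (α : Ordinal.{u}) (t : Set.Iio α → Bool) :
    ZFSet.{u} :=
  if Order.IsSuccLimit α then ZFSet.range fun β : {β : Set.Iio α // J β.1} =>
    limitCode J β.1.1 (truncate (Set.mem_Iio.1 β.1.2) t)
  else {ZFSet.pair α.toZFSet (ordSet t)}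
termination_by α
decreasing_by exact β.1.2

theorem limitCode_mem_HSet (J : Ordinal.{u} → Prop) {α : Ordinal.{u}} (hα : α < ω₁)
    (t : Set.Iio α → Bool) : limitCode J α t ∈ HSet ℵ₁ := by
  induction α using WellFoundedLT.induction with
  | _ α ih =>
    rw [limitCode]
    split_ifs with h
    · have := countable_Iio hα
      refine mem_HSet_aleph_one_of_countable (countable_range _) fun x hx => ?_
      obtain ⟨β, rfl⟩ := ZFSet.mem_range.1 hx
      exact ih _ β.1.2 (lt_trans β.1.2 hα) _
    · have h1 := toZFSet_mem_HSet hα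
      have h2 := ordSet_mem_HSet hα t
      rw [← Cardinal.succ_aleph0] at h1 h2 ⊢
      exact singleton_mem_HSet le_rfl (pair_mem_HSet le_rfl h1 h2)

/-- Below a limit, even nonlimit `β` are cofinal, and their codes are elements of the limit code
that record `β` and `t ↾ β`. They are singletons, whereas limit codes have at least two elements, so
the two kinds cannot be confused. -/
theorem limitCode_injective {J : Ordinal.{u} → Prop} (hJ : ∀ β, IsEvenOrd β → J β)
    {α : Ordinal.{u}} (hα : Order.IsSuccLimit α) : Function.Injective (limitCode J α) := by
  intro t t' h
  funext ⟨γ, hγ⟩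
  obtain ⟨β, hγβ, hβα, hβ, hβlim⟩ := exists_isEvenOrd_gt hα hγ
  have h1 : {ZFSet.pair β.toZFSet (ordSet (truncate hβα t))} ∈
      limitCode J α t := by
    rw [limitCode, if_pos hα]
    refine ZFSet.mem_range.2 ⟨⟨⟨β, hβα⟩, hJ β hβ⟩, ?_⟩
    rw [limitCode, if_neg hβlim]
  rw [h, limitCode, if_pos hα] at h1
  obtain ⟨⟨⟨δ, hδα⟩, hδ⟩, e⟩ := ZFSet.mem_range.1 h1
  rw [limitCode] at e
  split_ifs at e with hδlim
  · exfalso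
    -- The codes at `0` and at `ε > 0` would be the same element of a singleton, although they
    -- record different ordinals.
    obtain ⟨ε, hε0, hεδ, hε, hεlim⟩ := exists_isEvenOrd_gt hδlim hδlim.bot_lt
    have e1 := ZFSet.mem_singleton.1 (e ▸ ZFSet.mem_range_self
      (f := fun β : {β : Set.Iio δ // J β.1} =>
        limitCode J β.1.1 (truncate (Set.mem_Iio.1 β.1.2) (truncate hδα t'))) ⟨⟨ε, hεδ⟩, hJ ε hε⟩)
    have e2 := ZFSet.mem_singleton.1 (e ▸ ZFSet.mem_range_self
      (f := fun β : {β : Set.Iio δ // J β.1} =>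
        limitCode J β.1.1 (truncate (Set.mem_Iio.1 β.1.2) (truncate hδα t')))
      ⟨⟨0, hδlim.bot_lt⟩, hJ 0 isEvenOrd_zero⟩)
    rw [← e2, limitCode, if_neg hεlim, limitCode, if_neg (by simp), ZFSet.singleton_inj,
      ZFSet.pair_inj] at e1
    exact hε0.ne' (Ordinal.toZFSet_injective e1.1)
  · rw [ZFSet.singleton_inj, ZFSet.pair_inj] at e
    obtain ⟨e1, e2⟩ := e
    obtain rfl := Ordinal.toZFSet_injective e1
    exact (congrFun (ordSet_injective e2) ⟨γ, hγβ⟩).symm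

theorem codeSeq_limitCode (J : Ordinal.{u} → Prop) (f : Set.Iio (ω₁ : Ordinal.{u}) → Bool)
    {α : Ordinal.{u}} (hα : α < ω₁) (hlim : Order.IsSuccLimit α) :
    codeSeq (limitCode J) f α =
      ZFSet.range fun β : {β : Set.Iio α // J β.1} => codeSeq (limitCode J) f β.1.1 := by
  rw [codeSeq_eq _ _ hα, limitCode, if_pos hlim]
  congr 1
  funext β
  rw [codeSeq_eq _ _ (lt_trans β.1.2 hα)]
  rfl

theorem codeSeq_limitCode_mem_HSet (J : Ordinal.{u} → Prop)
    (f : Set.Iio (ω₁ : Ordinal.{u}) → Bool) {α : Ordinal.{u}} (hα : α < ω₁) :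
    codeSeq (limitCode J) f α ∈ HSet ℵ₁ := by
  rw [codeSeq_eq _ _ hα]
  exact limitCode_mem_HSet J hα _

theorem phi_of_diamondEL (hA : A ∈ HSet (Order.succ 𝔠))
    (hD : DiamondEL A B E (HSet (Order.succ 𝔠))) :
    Phi (countableSubsets A) B (liftRel A B E) := by
  refine phi_of_diamondELFor hA (c := limitCode fun _ => True)
    (fun α hα => limitCode_mem_HSet _ hα) (fun α => limitCode_injective fun _ _ => trivial)
    (fun f => ⟨fun α hα => codeSeq_limitCode_mem_HSet _ f hα, fun α hα hlim => ?_⟩) hD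
  rw [codeSeq_limitCode _ f hα hlim]
  ext x
  simp

open Classical in
/-- The play in which GOOD follows `σ` and BAD makes the moves `y α`. -/
noncomputable def play (σ : Strategy.{u}) (y : Ordinal.{u} → ZFSet.{u}) (α : Ordinal.{u}) :
    ZFSet.{u} :=
  if _h : IsEvenOrd α then y α else σ α.pred fun β => play σ y β.1
termination_by α
decreasing_by
  obtain h' | ⟨γ, -, rfl⟩ := isEvenOrd_or α
  · exact absurd h' _h
  · exact (Set.mem_Iic.1 β.2).trans_lt (by rw [Ordinal.pred_add_one]; exact lt_add_one γ)

theorem play_of_isEvenOrd (σ : Strategy.{u}) (y : Ordinal.{u} → ZFSet.{u}) {α : Ordinal.{u}}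
    (h : IsEvenOrd α) : play σ y α = y α := by
  rw [play, dif_pos h]

theorem follows_play (σ : Strategy.{u}) (y : Ordinal.{u} → ZFSet.{u}) :
    σ.Follows (play σ y) := fun α _ h => by
  rw [play, dif_neg h.not_add_one, Ordinal.pred_add_one]

/-- BAD plays the codes of the restrictions of `f`. His limit rule collects the even moves only,
hence the choice `J = IsEvenOrd`. -/
theorem phi_of_diamondSTR (hA : A ∈ HSet (Order.succ 𝔠))
    (hD : DiamondSTR A B E (HSet (Order.succ 𝔠))) :
    Phi (countableSubsets A) B (liftRel A B E) := by
  refine phi_of_codes hA (c := limitCode IsEvenOrd)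
    (fun α hα => limitCode_mem_HSet _ hα) (fun α => limitCode_injective fun _ => id)
    fun h hh => ?_
  obtain ⟨b, hb, σ, hσ⟩ := hD h hh
  refine ⟨b, hb, fun f => ?_⟩
  have hbad : BadLegal (play σ (codeSeq (limitCode IsEvenOrd) f)) := fun α hα he => by
    rw [play_of_isEvenOrd _ _ he]
    refine ⟨codeSeq_limitCode_mem_HSet _ f hα, fun hlim => ?_⟩
    rw [codeSeq_limitCode _ f hα hlim]
    congr 1
    funext β
    rw [play_of_isEvenOrd _ _ β.2]
  obtain ⟨hlegal, hwin⟩ := hσ _ hbad (follows_play _ _)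
  refine ⟨fun α => play σ (codeSeq (limitCode IsEvenOrd) f) (α + 1), fun α hlim => ?_,
    hwin.mono fun α hα => hα.2⟩
  have he := isEvenOrd_of_isSuccLimit hlim
  obtain ⟨h1, h2⟩ := hlegal α.1 α.2 he
  rw [play_of_isEvenOrd _ _ he, codeSeq_eq _ _ α.2] at h2
  exact ⟨h1, _, h2⟩

end ParamDiamond

theorem mainTheorem2 (A B E : ZFSet.{u}) (hABE : ParamDiamond.IsInvariant A B E) :
    List.TFAE
      [ParamDiamond.DiamondSTR A B E (ParamDiamond.HSet (Order.succ 𝔠)),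
       ParamDiamond.DiamondEL A B E (ParamDiamond.HSet (Order.succ 𝔠)),
       ParamDiamond.DiamondELInitial A B E (ParamDiamond.HSet (Order.succ 𝔠)),
       ParamDiamond.Phi (ParamDiamond.countableSubsets A) B (ParamDiamond.liftRel A B E)] := by
  tfae_have 1 → 4 := ParamDiamond.phi_of_diamondSTR hABE.left_mem
  tfae_have 2 → 4 := ParamDiamond.phi_of_diamondEL hABE.left_mem
  tfae_have 3 → 4 := ParamDiamond.phi_of_diamondELInitial hABE.left_mem
  tfae_have 4 → 1 := ParamDiamond.diamondSTR_of_phi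
  tfae_have 4 → 2 := ParamDiamond.diamondEL_of_phi
  tfae_have 4 → 3 := ParamDiamond.diamondELInitial_of_phi
  tfae_finish
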